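/- For a polynomial $f\in\mathbb{C}[h]$, let $\mathcal{H}(f)$ be the (unital) associative $\mathbb{C}$-algebra generated by $x,y,h$ with defining relations $$hx=xf(h),\qquad yh=f(h)y,\qquad yx-xy=f(h)-h.$$ Let $f_1,f_2\in\mathbb{C}[h]$. Then $\mathcal{H}(f_1)\cong\mathcal{H}(f_2)$ as $\mathbb{C}$-algebras if and only if one of the following holds: 1. $f_1,f_2\in\mathbb{C}$ (both are constant); 2. $f_1=f_2=h$; 3. $f_1=h+c_1$ and $f_2=h+c_2$ for some $c_1,c_2\in\mathbb{C}\setminus\{0\}$; 4. $f_1=a_1h+b_1$ and $f_2=a_2h+b_2$ for some $a_1,a_2,b_1,b_2\in\mathbb{C}$ with $a_1=a_2$ or $a_1=a_2^{-1}$, and $a_1\neq 1$; 5. $\deg f_1\ge 2$ and $f_2(h)=a\,f_1\bigl(a^{-1}(h-c)\bigr)+c$ for some $a\in\mathbb{C}\setminus\{0\}$ and $c\in\mathbb{C}$. -/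

import Mathlib

open Polynomial

/-- The three generators of a generalized Heisenberg algebra. -/
inductive GHGen : Type
  | x : GHGen
  | y : GHGen
  | h : GHGen

/-- The defining relations of the generalized Heisenberg algebra of `f ∈ ℂ[h]`, as a relation on the
free associative unital `ℂ`-algebra on `x, y, h`:
`h x = x f(h)`, `y h = f(h) y`, `[y, x] = f(h) - h`, with `f(h)` the value of `f` at `h`. -/
inductive GHRel (f : ℂ[X]) : FreeAlgebra ℂ GHGen → FreeAlgebra ℂ GHGen → Prop
  | hx : GHRel f
      (FreeAlgebra.ι ℂ GHGen.h * FreeAlgebra.ι ℂ GHGen.x)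
      (FreeAlgebra.ι ℂ GHGen.x * aeval (FreeAlgebra.ι ℂ GHGen.h) f)
  | yh : GHRel f
      (FreeAlgebra.ι ℂ GHGen.y * FreeAlgebra.ι ℂ GHGen.h)
      (aeval (FreeAlgebra.ι ℂ GHGen.h) f * FreeAlgebra.ι ℂ GHGen.y)
  | yx : GHRel f
      (FreeAlgebra.ι ℂ GHGen.y * FreeAlgebra.ι ℂ GHGen.x
        - FreeAlgebra.ι ℂ GHGen.x * FreeAlgebra.ι ℂ GHGen.y)
      (aeval (FreeAlgebra.ι ℂ GHGen.h) f - FreeAlgebra.ι ℂ GHGen.h)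

/-- The generalized Heisenberg algebra `𝓗(f)`: the associative unital `ℂ`-algebra generated by
`x, y, h` subject to the relations `GHRel f`. -/
abbrev GenHeisenbergAlgebra (f : ℂ[X]) : Type := RingQuot (GHRel f)

/-! Sufficiency: an affine change of `h`, with `y` rescaled, realizes conjugation of `f` by an
affine map, and exchanging `x` and `y` turns `a * h` into `a⁻¹ * h`. These two moves give all the
listed isomorphisms.

Necessity in degree at least 2 rests on the normal form `∑ xⁱ p(h) yᵏ`. Leading exponents add under
multiplication once `f` is nonconstant. If `t` is the image of `h` and `v` that of `x`, then `t v =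
v f₁(t)`, and comparing leading exponents forces `t` to be a polynomial in `h`
(`exists_eq_aeval_h`). Comparing leading coefficients gives `t ∘ f₂ⁱ = f₁ ∘ t ∘ f₂ᵏ`, powers meaning
iterates (`exists_comp_eq`). Degrees, used for the isomorphism and its inverse, yield `i = k + 1`;
cancelling iterates leaves `t ∘ f₂ = f₁ ∘ t`, and `t` is affine because it has a compositional
inverse (`affine_conj_of_equiv`).

Necessity in degree at most 1: for slope other than 1, a triangular 2 by 2 representation over
`ℂ[X]` recovers the slope up to inversion (`linear_of_equiv`). For slope 1, the algebra of `X` is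
commutative and that of `X + b` with `b ≠ 0` is not. -/

namespace GenHeisenberg

/-! ### Presentation and universal property -/

/-- The image of a generator in the generalized Heisenberg algebra. -/
noncomputable def gen (f : ℂ[X]) (g : GHGen) : GenHeisenbergAlgebra f :=
  RingQuot.mkAlgHom ℂ (GHRel f) (FreeAlgebra.ι ℂ g)

lemma mk_aeval (f p : ℂ[X]) :
    RingQuot.mkAlgHom ℂ (GHRel f) (aeval (FreeAlgebra.ι ℂ GHGen.h) p) = aeval (gen f .h) p :=
  (aeval_algHom_apply _ _ _).symm

lemma h_mul_x (f : ℂ[X]) : gen f .h * gen f .x = gen f .x * aeval (gen f .h) f := by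
  have := RingQuot.mkAlgHom_rel ℂ (GHRel.hx (f := f))
  rwa [map_mul, map_mul, mk_aeval] at this

lemma y_mul_h (f : ℂ[X]) : gen f .y * gen f .h = aeval (gen f .h) f * gen f .y := by
  have := RingQuot.mkAlgHom_rel ℂ (GHRel.yh (f := f))
  rwa [map_mul, map_mul, mk_aeval] at this

lemma commutator_y_x (f : ℂ[X]) :
    gen f .y * gen f .x - gen f .x * gen f .y = aeval (gen f .h) f - gen f .h := by
  have := RingQuot.mkAlgHom_rel ℂ (GHRel.yx (f := f))
  rwa [map_sub, map_sub, map_mul, map_mul, mk_aeval] at this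

/-- Triples in an algebra that satisfy the relations of the generalized Heisenberg algebra. -/
structure IsTriple {A : Type*} [Ring A] [Algebra ℂ A] (f : ℂ[X]) (x y h : A) : Prop where
  hx : h * x = x * aeval h f
  yh : y * h = aeval h f * y
  yx : y * x - x * y = aeval h f - h

lemma isTriple_gen (f : ℂ[X]) : IsTriple f (gen f .x) (gen f .y) (gen f .h) :=
  ⟨h_mul_x f, y_mul_h f, commutator_y_x f⟩

lemma IsTriple.map {A B : Type*} [Ring A] [Algebra ℂ A] [Ring B] [Algebra ℂ B] {f : ℂ[X]}
    {x y h : A} (t : IsTriple f x y h) (φ : A →ₐ[ℂ] B) : IsTriple f (φ x) (φ y) (φ h) := by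
  constructor
  · rw [aeval_algHom_apply, ← map_mul, t.hx, map_mul]
  · rw [aeval_algHom_apply, ← map_mul, t.yh, map_mul]
  · rw [aeval_algHom_apply, ← map_mul, ← map_mul, ← map_sub, t.yx, map_sub]

/-- The values of a map out of the generators. -/
def genVal {A : Type*} (x y h : A) : GHGen → A
  | .x => x
  | .y => y
  | .h => h

/-- The universal property of the generalized Heisenberg algebra. -/
noncomputable def lift {A : Type*} [Ring A] [Algebra ℂ A] {f : ℂ[X]} {x y h : A}
    (t : IsTriple f x y h) : GenHeisenbergAlgebra f →ₐ[ℂ] A :=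
  RingQuot.liftAlgHom ℂ ⟨FreeAlgebra.lift ℂ (genVal x y h), by
    intro a b r
    cases r
    · simpa [← aeval_algHom_apply, genVal] using t.hx
    · simpa [← aeval_algHom_apply, genVal] using t.yh
    · simpa [← aeval_algHom_apply, genVal] using t.yx⟩

@[simp] lemma lift_gen {A : Type*} [Ring A] [Algebra ℂ A] {f : ℂ[X]} {x y h : A}
    (t : IsTriple f x y h) (g : GHGen) : lift t (gen f g) = genVal x y h g := by
  simp [lift, gen]

lemma gen_induction {f : ℂ[X]} {P : GenHeisenbergAlgebra f → Prop}
    (scalar : ∀ c : ℂ, P (algebraMap ℂ _ c)) (hx : P (gen f .x)) (hy : P (gen f .y))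
    (hh : P (gen f .h)) (add : ∀ a b, P a → P b → P (a + b)) (mul : ∀ a b, P a → P b → P (a * b))
    (w : GenHeisenbergAlgebra f) : P w := by
  obtain ⟨w, rfl⟩ := RingQuot.mkAlgHom_surjective ℂ (GHRel f) w
  induction w using FreeAlgebra.induction with
  | grade0 r => simpa using scalar r
  | grade1 g => cases g <;> assumption
  | mul a b ha hb => rw [map_mul]; exact mul _ _ ha hb
  | add a b ha hb => rw [map_add]; exact add _ _ ha hb

lemma algHom_ext {A : Type*} [Ring A] [Algebra ℂ A] {f : ℂ[X]}
    {φ ψ : GenHeisenbergAlgebra f →ₐ[ℂ] A} (hx : φ (gen f .x) = ψ (gen f .x))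
    (hy : φ (gen f .y) = ψ (gen f .y)) (hh : φ (gen f .h) = ψ (gen f .h)) : φ = ψ := by
  refine AlgHom.ext fun w => ?_
  induction w using gen_induction with
  | scalar c => simp
  | hx => exact hx
  | hy => exact hy
  | hh => exact hh
  | add a b ha hb => rw [map_add, map_add, ha, hb]
  | mul a b ha hb => rw [map_mul, map_mul, ha, hb]

lemma commute_of_commute_gen {A : Type*} [Ring A] [Algebra ℂ A] {f : ℂ[X]}
    (φ : GenHeisenbergAlgebra f →ₐ[ℂ] A)
    (hxy : Commute (φ (gen f .x)) (φ (gen f .y))) (hxh : Commute (φ (gen f .x)) (φ (gen f .h)))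
    (hyh : Commute (φ (gen f .y)) (φ (gen f .h))) (v w : GenHeisenbergAlgebra f) :
    Commute (φ v) (φ w) := by
  have key (a : A) (hx : Commute a (φ (gen f .x))) (hy : Commute a (φ (gen f .y)))
      (hh : Commute a (φ (gen f .h))) (w : GenHeisenbergAlgebra f) : Commute a (φ w) := by
    induction w using gen_induction with
    | scalar c => rw [AlgHom.commutes]; exact Algebra.commute_algebraMap_right c a
    | hx => exact hx
    | hy => exact hy
    | hh => exact hh
    | add v w hv hw => rw [map_add]; exact hv.add_right hw
    | mul v w hv hw => rw [map_mul]; exact hv.mul_right hw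
  exact key _ (key _ (.refl _) hxy hxh v).symm (key _ hxy.symm (.refl _) hyh v).symm
    (key _ hxh.symm hyh.symm (.refl _) v).symm w

/-! ### Explicit isomorphisms -/

section Isomorphisms

lemma aeval_affine_conj {A : Type*} [Ring A] [Algebra ℂ A] (f : ℂ[X]) (a c : ℂ) (h : A) :
    aeval h (C a * f.comp (C a⁻¹ * (X - C c)) + C c) =
      a • aeval (a⁻¹ • (h - algebraMap ℂ A c)) f + algebraMap ℂ A c := by
  simp [aeval_comp, Algebra.smul_def]

/-- With `k` the new `h`, `f₁(k)` is the same affine function of `f₂(h)` as `k` is of `h`. The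
difference `f₁(k) - k` therefore only picks up the factor `a⁻¹`, which scaling `y` absorbs. -/
lemma isTriple_affine_conj {A : Type*} [Ring A] [Algebra ℂ A] {f₁ f₂ : ℂ[X]} {a c : ℂ}
    (ha : a ≠ 0) (hf : f₂ = C a * f₁.comp (C a⁻¹ * (X - C c)) + C c) {x y h : A}
    (t : IsTriple f₂ x y h) :
    IsTriple f₁ x (a⁻¹ • y) (a⁻¹ • (h - algebraMap ℂ A c)) := by
  set k := a⁻¹ • (h - algebraMap ℂ A c) with hk
  have hh : h = a • k + algebraMap ℂ A c := by simp [hk, smul_smul, ha]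
  have e : aeval h f₂ = a • aeval k f₁ + algebraMap ℂ A c := by
    rw [hf, aeval_affine_conj]
  have ek : aeval k f₁ = a⁻¹ • (aeval h f₂ - algebraMap ℂ A c) := by
    simp [e, smul_smul, ha]
  have c1 := Algebra.commutes c x
  have c2 := Algebra.commutes c y
  constructor
  · rw [ek, hk, smul_mul_assoc, mul_smul_comm, sub_mul, mul_sub, t.hx, c1]
  · rw [ek, hk]
    simp only [smul_mul_assoc, mul_smul_comm, sub_mul, mul_sub, t.yh, c2, smul_sub]
  · rw [ek, hk, smul_mul_assoc, mul_smul_comm, ← smul_sub, t.yx, ← smul_sub]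
    congr 1
    abel

lemma affine_conj_symm {f₁ f₂ : ℂ[X]} {a c : ℂ}
    (ha : a ≠ 0) (hf : f₂ = C a * f₁.comp (C a⁻¹ * (X - C c)) + C c) :
    f₁ = C a⁻¹ * f₂.comp (C a⁻¹⁻¹ * (X - C (-(a⁻¹ * c)))) + C (-(a⁻¹ * c)) := by
  have hC : (C a⁻¹ : ℂ[X]) * C a = 1 := by rw [← C_mul, inv_mul_cancel₀ ha, C_1]
  have : (C a⁻¹ * (X - C c) : ℂ[X]).comp (C a⁻¹⁻¹ * (X - C (-(a⁻¹ * c)))) = X := by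
    simp only [mul_comp, sub_comp, X_comp, C_comp, inv_inv, C_neg, C_mul]
    linear_combination (X + C a⁻¹ * C c) * hC
  rw [hf, add_comp, mul_comp, comp_assoc, this]
  simp only [C_comp, comp_X, C_neg, C_mul]
  linear_combination (-f₁) * hC

theorem nonempty_equiv_of_affine_conj {f₁ f₂ : ℂ[X]} {a c : ℂ} (ha : a ≠ 0)
    (hf : f₂ = C a * f₁.comp (C a⁻¹ * (X - C c)) + C c) :
    Nonempty (GenHeisenbergAlgebra f₁ ≃ₐ[ℂ] GenHeisenbergAlgebra f₂) := by
  refine ⟨AlgEquiv.ofAlgHom (lift (isTriple_affine_conj ha hf (isTriple_gen f₂)))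
    (lift (isTriple_affine_conj (inv_ne_zero ha) (affine_conj_symm ha hf) (isTriple_gen f₁)))
    (algHom_ext ?_ ?_ ?_) (algHom_ext ?_ ?_ ?_)⟩ <;>
  simp [genVal, smul_smul, ha, Algebra.algebraMap_eq_smul_one, smul_sub]

/-- The new `h` is the old `f(h)`, so `a⁻¹` recovers the old `h` and both sides of the commutator
relation change sign. -/
lemma isTriple_swap {A : Type*} [Ring A] [Algebra ℂ A] {a : ℂ} (ha : a ≠ 0) {x y h : A}
    (t : IsTriple (C a * X) x y h) : IsTriple (C a⁻¹ * X) y x (a • h) := by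
  obtain ⟨t1, t2, t3⟩ := t
  simp only [map_mul, aeval_C, aeval_X, ← Algebra.smul_def, mul_smul_comm, smul_mul_assoc]
    at t1 t2 t3
  constructor <;> simp only [map_mul, aeval_C, aeval_X, ← Algebra.smul_def, mul_smul_comm,
    smul_mul_assoc, smul_smul, mul_inv_cancel₀ ha, one_smul]
  · exact t2.symm
  · exact t1.symm
  · rw [← neg_sub, t3, neg_sub]

theorem nonempty_equiv_linear_inv {a : ℂ} (ha : a ≠ 0) :
    Nonempty (GenHeisenbergAlgebra (C a * X) ≃ₐ[ℂ] GenHeisenbergAlgebra (C a⁻¹ * X)) := by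
  have t := isTriple_swap (inv_ne_zero ha) (isTriple_gen (C a⁻¹ * X))
  rw [inv_inv] at t
  refine ⟨AlgEquiv.ofAlgHom (lift t) (lift (isTriple_swap ha (isTriple_gen (C a * X))))
    (algHom_ext ?_ ?_ ?_) (algHom_ext ?_ ?_ ?_)⟩ <;>
  simp [genVal, smul_smul, ha]

/-- Translation moves the fixed point `b / (1 - a)` of the affine map to the origin. -/
lemma nonempty_equiv_linear (a b : ℂ) (ha : a ≠ 1) :
    Nonempty (GenHeisenbergAlgebra (C a * X) ≃ₐ[ℂ] GenHeisenbergAlgebra (C a * X + C b)) := by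
  have h1 : (1 - a) ≠ 0 := sub_ne_zero.mpr ha.symm
  refine nonempty_equiv_of_affine_conj (a := 1) (c := b / (1 - a)) one_ne_zero ?_
  have : (C b : ℂ[X]) = C (b / (1 - a)) * (1 - C a) := by
    rw [← C_1, ← C_sub, ← C_mul, div_mul_cancel₀ _ h1]
  simp only [mul_comp, C_comp, X_comp, inv_one, C_1, one_mul]
  rw [this]
  ring

end Isomorphisms

/-! ### Degree at most one: recovering the slope -/

section Linear

/-- The upper triangular representation of `𝓗(aX + b)` over `ℂ[X]` at the fixed point `c`. -/
lemma isTriple_triangular {f : ℂ[X]} {a b c : ℂ} (hf : f = C a * X + C b)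
    (hc : a * c + b = c) : IsTriple (A := Matrix (Fin 2) (Fin 2) ℂ[X]) f
      !![X, 0; 0, C a * X] !![0, 1; 0, 0] !![C c, X; 0, C c] := by
  have hC : C a * C c + C b = C c := by rw [← C_mul, ← C_add, hc]
  have e : aeval (!![C c, X; 0, C c] : Matrix (Fin 2) (Fin 2) ℂ[X]) f =
      !![C c, C a * X; 0, C c] := by
    ext1 i j
    fin_cases i <;> fin_cases j <;>
      simp [hf, Matrix.mul_apply, Matrix.algebraMap_matrix_apply, hC]
  constructor <;> rw [e] <;> ext1 i j <;> fin_cases i <;> fin_cases j <;>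
    (simp [Matrix.mul_apply, Fin.sum_univ_two]; try ring)

/-- The character family of `𝓗(aX + b)` on the line `y = 0`. -/
lemma isTriple_line {f : ℂ[X]} {a b c : ℂ} (hf : f = C a * X + C b)
    (hc : a * c + b = c) : IsTriple (A := ℂ[X]) f X 0 (C c) := by
  have e : aeval (C c : ℂ[X]) f = C c := by
    have hC : C a * C c + C b = C c := by rw [← C_mul, ← C_add, hc]
    simp only [hf, map_add, map_mul, aeval_C, aeval_X, algebraMap_eq, hC]
  constructor <;> simp only [e] <;> ring

lemma triangular_apply {f : ℂ[X]} {a b c : ℂ} (hf : f = C a * X + C b) (hc : a * c + b = c)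
    (w : GenHeisenbergAlgebra f) :
    lift (isTriple_triangular hf hc) w 1 0 = 0 ∧
      lift (isTriple_triangular hf hc) w 0 0 = lift (isTriple_line hf hc) w ∧
      lift (isTriple_triangular hf hc) w 1 1 = (lift (isTriple_line hf hc) w).comp (C a * X) := by
  induction w using gen_induction with
  | scalar r => simp [Matrix.algebraMap_matrix_apply]
  | hx => simp [genVal]
  | hy => simp [genVal]
  | hh => simp [genVal]
  | add v w hv hw => simp [hv, hw]
  | mul v w hv hw => simp [hv, hw, Matrix.mul_apply, Fin.sum_univ_two]

theorem linear_of_equiv {f₁ f₂ : ℂ[X]} {a₁ a₂ b₁ b₂ : ℂ} (hf₁ : f₁ = C a₁ * X + C b₁)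
    (hf₂ : f₂ = C a₂ * X + C b₂) (h2 : a₂ ≠ 1)
    (φ : GenHeisenbergAlgebra f₁ ≃ₐ[ℂ] GenHeisenbergAlgebra f₂) :
    a₁ ≠ 1 ∧ (a₁ = a₂ ∨ a₁ * a₂ = 1) := by
  have h2' : 1 - a₂ ≠ 0 := sub_ne_zero.mpr h2.symm
  obtain ⟨c, hc⟩ : ∃ c, a₂ * c + b₂ = c := ⟨b₂ / (1 - a₂), by field_simp; ring⟩
  set ρ := lift (isTriple_triangular hf₂ hc)
  set δ := lift (isTriple_line hf₂ hc)
  have tri (w) : ρ w 1 0 = 0 ∧ ρ w 0 0 = δ w ∧ ρ w 1 1 = (δ w).comp (C a₂ * X) :=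
    triangular_apply hf₂ hc w
  set x := φ (gen f₁ .x)
  set y := φ (gen f₁ .y)
  set h := φ (gen f₁ .h)
  have t : IsTriple f₁ x y h := (isTriple_gen f₁).map φ.toAlgHom
  have t1 : IsTriple f₁ (ρ x) (ρ y) (ρ h) := t.map ρ
  have t2 : IsTriple f₁ (δ x) (δ y) (δ h) := t.map δ
  -- The target of `δ` is commutative, so the commutator relation says that `δ h` is fixed by `f₁`.
  have hδ : (C a₁ - 1) * δ h + C b₁ = 0 := by
    have := t2.yx
    simp only [hf₁, map_add, map_mul, aeval_C, aeval_X, algebraMap_eq] at this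
    linear_combination -this
  -- The image of `ρ` is not commutative: `x y` and `y x` have corner entries `X` and `a₂ X`.
  have noncomm : ¬ (Commute (ρ x) (ρ y) ∧ Commute (ρ x) (ρ h) ∧ Commute (ρ y) (ρ h)) := by
    rintro ⟨e1, e2, e3⟩
    have := (commute_of_commute_gen (ρ.comp φ.toAlgHom) e1 e2 e3 (φ.symm (gen f₂ .x))
      (φ.symm (gen f₂ .y))).eq
    have hx : (ρ.comp φ.toAlgHom) (φ.symm (gen f₂ .x)) = !![X, 0; 0, C a₂ * X] := by
      simp [ρ, genVal]
    have hy : (ρ.comp φ.toAlgHom) (φ.symm (gen f₂ .y)) = !![0, 1; 0, 0] := by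
      simp [ρ, genVal]
    rw [hx, hy] at this
    have := congrArg (fun p : ℂ[X] => p.coeff 1) (congrFun (congrFun this 0) 1)
    simp [Matrix.mul_apply, Fin.sum_univ_two] at this
    exact h2 this.symm
  have e (T : Matrix (Fin 2) (Fin 2) ℂ[X]) :
      aeval T f₁ = C a₁ • T + algebraMap ℂ _ b₁ := by
    simp [hf₁, Algebra.smul_def]
    rfl
  have h1 : a₁ ≠ 1 := by
    rintro rfl
    have hb : b₁ = 0 := by simpa using hδ
    obtain ⟨u1, u2, u3⟩ := t1
    rw [e] at u1 u2 u3
    simp only [hb, C_1, one_smul, map_zero, add_zero, sub_self] at u1 u2 u3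
    exact noncomm ⟨(sub_eq_zero.mp u3).symm, u1.symm, u2⟩
  have h1' : a₁ - 1 ≠ 0 := sub_ne_zero.mpr h1
  obtain ⟨μ, hμ, hμ'⟩ : ∃ μ, δ h = C μ ∧ a₁ * μ + b₁ = μ := by
    refine ⟨-b₁ / (a₁ - 1), ?_, by field_simp; ring⟩
    have : (C (a₁ - 1) : ℂ[X]) ≠ 0 := C_ne_zero.mpr h1'
    apply mul_left_cancel₀ this
    rw [← C_mul, mul_div_cancel₀ _ h1']
    rw [C_sub, C_1, C_neg]
    linear_combination hδ
  have h00 : ρ h 0 0 = C μ := by rw [(tri h).2.1, hμ]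
  have h11 : ρ h 1 1 = C μ := by rw [(tri h).2.2, hμ, C_comp]
  have hC : C a₁ * C μ + C b₁ = C μ := by rw [← C_mul, ← C_add, hμ']
  -- If the corner vanished, `ρ h` would be a scalar fixed by `f₁`, and all three images would
  -- commute.
  have hne : ρ h 0 1 ≠ 0 := by
    intro h0
    have hs : ρ h = algebraMap ℂ _ μ := by
      ext1 i j
      fin_cases i <;> fin_cases j <;>
        simp [Matrix.algebraMap_matrix_apply, h00, h11, h0, (tri h).1]
    have u3 := t1.yx
    rw [hs, aeval_algebraMap_apply] at u3
    have : aeval μ f₁ = μ := by simp [hf₁, hμ']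
    rw [this, sub_self, sub_eq_zero] at u3
    refine noncomm ⟨u3.symm, ?_, ?_⟩ <;> rw [hs] <;>
      exact Algebra.commute_algebraMap_right _ _
  -- In the corner entry of the relation the terms in `ρ x 0 1` cancel because `μ` is fixed by `f₁`;
  -- what remains is a multiple of `ρ h 0 1`.
  have hp : (δ x).comp (C a₂ * X) = C a₁ * δ x := by
    apply mul_left_cancel₀ hne
    have := congrFun (congrFun t1.hx 0) 1
    rw [e] at this
    simp [Matrix.mul_apply, Fin.sum_univ_two, Matrix.algebraMap_matrix_apply, h00, h11,
      (tri x).2.1, (tri x).2.2] at this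
    linear_combination this + ρ x 0 1 * hC
  have hq : δ y = C a₁ * (δ y).comp (C a₂ * X) := by
    apply mul_left_cancel₀ hne
    have := congrFun (congrFun t1.yh 0) 1
    rw [e] at this
    simp [Matrix.mul_apply, Fin.sum_univ_two, Matrix.algebraMap_matrix_apply, h00, h11,
      (tri y).2.1, (tri y).2.2] at this
    linear_combination this + ρ y 0 1 * hC
  have hp1 := congrArg (fun p : ℂ[X] => p.coeff 1) hp
  have hq1 := congrArg (fun p : ℂ[X] => p.coeff 1) hq
  simp only [comp_C_mul_X_coeff, coeff_C_mul, pow_one] at hp1 hq1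
  refine ⟨h1, ?_⟩
  by_contra! hcon
  have px : (δ x).coeff 1 = 0 := by
    by_contra h0
    exact hcon.1 (mul_right_cancel₀ h0 (by linear_combination -hp1))
  have py : (δ y).coeff 1 = 0 := by
    by_contra h0
    exact hcon.2 (mul_right_cancel₀ h0 (by linear_combination -hq1))
  -- Polynomials without linear term form a subalgebra. If neither slope relation holds, it contains
  -- the whole image of `δ`, yet `X` is in that image.
  have all (w : GenHeisenbergAlgebra f₁) : (δ (φ w)).coeff 1 = 0 := by
    induction w using gen_induction with
    | scalar r => simp
    | hx => exact px
    | hy => exact py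
    | hh => change (δ h).coeff 1 = 0; simp [hμ]
    | add v w hv hw => simp [hv, hw]
    | mul v w hv hw => simp [hv, hw, coeff_mul, Finset.Nat.antidiagonal_succ]
  have := all (φ.symm (gen f₂ .x))
  simp [δ, genVal] at this

end Linear

/-! ### Normal forms, via a representation on coefficient arrays -/

section NormalForm

variable (f : ℂ[X])

lemma iterate_comp_comp (i : ℕ) : (f.comp^[i] X).comp f = f.comp^[i + 1] X := by
  induction i with
  | zero => simp
  | succ i ih => rw [Function.iterate_succ_apply', comp_assoc, ih,
      ← Function.iterate_succ_apply' f.comp]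

/-- Left multiplication by `x` on the coefficients `v i k` of normal forms `∑ xⁱ (v i k)(h) yᵏ`. -/
noncomputable def opX : Module.End ℂ (ℕ → ℕ → ℂ[X]) where
  toFun v i k := if i = 0 then 0 else v (i - 1) k
  map_add' v w := by ext1 i; ext1 k; by_cases h : i = 0 <;> simp [h]
  map_smul' r v := by ext1 i; ext1 k; by_cases h : i = 0 <;> simp [h]

/-- Left multiplication by `h` on the coefficients of normal forms. -/
noncomputable def opH : Module.End ℂ (ℕ → ℕ → ℂ[X]) where
  toFun v i k := f.comp^[i] X * v i k
  map_add' v w := by ext1 i; ext1 k; simp [mul_add]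
  map_smul' r v := by ext1 i; ext1 k; simp

/-- Left multiplication by `y` on the coefficients of normal forms. -/
noncomputable def opY : Module.End ℂ (ℕ → ℕ → ℂ[X]) where
  -- The summands come from moving `y` past `xⁱ p(h)`: it composes `p` with `f`, while `y xⁱ⁺¹`
  -- leaves the correction `xⁱ (fⁱ⁺¹(h) - h)`, which lands one step lower in `i`.
  toFun v i k := (if k = 0 then 0 else (v i (k - 1)).comp f) +
    (f.comp^[i + 1] X - X) * v (i + 1) k
  map_add' v w := by ext1 i; ext1 k; by_cases h : k = 0 <;> simp [h] <;> ring
  map_smul' r v := by ext1 i; ext1 k; by_cases h : k = 0 <;> simp [h]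

lemma aeval_opH_apply (p : ℂ[X]) (v : ℕ → ℕ → ℂ[X]) (i k : ℕ) :
    aeval (opH f) p v i k = p.comp (f.comp^[i] X) * v i k := by
  induction p using Polynomial.induction_on' with
  | add p q hp hq => simp [hp, hq, add_mul]
  | monomial n a =>
    rw [← C_mul_X_pow_eq_monomial]
    have (n : ℕ) : ((opH f) ^ n) v i k = (f.comp^[i] X) ^ n * v i k := by
      induction n with
      | zero => simp
      | succ n ih =>
        rw [pow_succ', Module.End.mul_apply]
        change f.comp^[i] X * ((opH f) ^ n) v i k = _
        rw [ih]; ring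
    simp [this, smul_eq_C_mul, mul_assoc]

lemma isTriple_op : IsTriple f opX (opY f) (opH f) := by
  have e (v : ℕ → ℕ → ℂ[X]) (i k : ℕ) :
      aeval (opH f) f v i k = f.comp^[i + 1] X * v i k := by
    rw [aeval_opH_apply, Function.iterate_succ_apply']
  constructor <;> ext1 v <;> ext1 i <;> ext1 k
  · change f.comp^[i] X * opX v i k = opX (aeval (opH f) f v) i k
    cases i with
    | zero => simp [opX]
    | succ i => simp [opX, e]
  · change opY f (opH f v) i k = aeval (opH f) f (opY f v) i k
    rw [e]
    cases k with
    | zero => simp [opY, opH]; ring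
    | succ k =>
      simp only [opY, opH, LinearMap.coe_mk, AddHom.coe_mk, Nat.add_eq_zero_iff, one_ne_zero,
        and_false, if_false, Nat.add_sub_cancel, mul_comp, iterate_comp_comp]
      ring
  · change opY f (opX v) i k - opX (opY f v) i k =
      aeval (opH f) f v i k - opH f v i k
    rw [e]
    cases i with
    | zero => cases k <;> simp [opX, opY, opH] <;> ring
    | succ i => cases k <;> simp [opX, opY, opH] <;> ring

/-- The action of the generalized Heisenberg algebra on coefficients of normal forms. -/
noncomputable def act : GenHeisenbergAlgebra f →ₐ[ℂ] Module.End ℂ (ℕ → ℕ → ℂ[X]) :=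
  lift (isTriple_op f)

lemma act_x : act f (gen f .x) = opX := lift_gen _ _
lemma act_y : act f (gen f .y) = opY f := lift_gen _ _
lemma act_h : act f (gen f .h) = opH f := lift_gen _ _

lemma act_aeval_h (p : ℂ[X]) : act f (aeval (gen f .h) p) = aeval (opH f) p := by
  rw [← aeval_algHom_apply, act_h]

/-- The coefficients of the normal form of an element. -/
noncomputable def coeffs (w : GenHeisenbergAlgebra f) : ℕ → ℕ → ℂ[X] :=
  act f w (fun i k => if i = 0 ∧ k = 0 then 1 else 0)

/-- The monomial `xⁱ p(h) yᵏ`. -/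
noncomputable def mono (i k : ℕ) (p : ℂ[X]) : GenHeisenbergAlgebra f :=
  gen f .x ^ i * aeval (gen f .h) p * gen f .y ^ k

lemma opX_pow_apply (v : ℕ → ℕ → ℂ[X]) (n i k : ℕ) :
    (opX ^ n) v i k = if i < n then 0 else v (i - n) k := by
  induction n generalizing i with
  | zero => simp
  | succ n ih =>
    rw [pow_succ', Module.End.mul_apply]
    change (if i = 0 then 0 else (opX ^ n) v (i - 1) k) = _
    rw [ih]
    rcases i with _ | i
    · simp
    · simp

lemma coeffs_y_pow (n i k : ℕ) :
    coeffs f (gen f .y ^ n) i k = if i = 0 ∧ k = n then 1 else 0 := by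
  induction n generalizing i k with
  | zero => simp [coeffs]
  | succ n ih =>
    have : coeffs f (gen f .y ^ (n + 1)) = opY f (coeffs f (gen f .y ^ n)) := by
      rw [pow_succ', coeffs, map_mul, Module.End.mul_apply, act_y]; rfl
    rw [this]
    change (if k = 0 then 0 else (coeffs f (gen f .y ^ n) i (k - 1)).comp f) +
      (f.comp^[i + 1] X - X) * coeffs f (gen f .y ^ n) (i + 1) k = _
    rw [ih, ih]
    rcases k with _ | k
    · simp
    · by_cases h : i = 0 ∧ k = n <;> simp [h]

lemma coeffs_mono (i k : ℕ) (p : ℂ[X]) (i' k' : ℕ) :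
    coeffs f (mono f i k p) i' k' = if i' = i ∧ k' = k then p else 0 := by
  have : coeffs f (mono f i k p) = (opX ^ i) (aeval (opH f) p (coeffs f (gen f .y ^ k))) := by
    rw [mono, coeffs, map_mul, map_mul, map_pow, act_x, act_aeval_h]; rfl
  rw [this, opX_pow_apply, aeval_opH_apply, coeffs_y_pow]
  by_cases h : i' < i
  · simp [h]; intro h1; omega
  · by_cases h1 : i' = i ∧ k' = k
    · simp [h1]
    · have : ¬ (i' - i = 0 ∧ k' = k) := by omega
      simp [h, h1, this]

@[simp] lemma coeffs_add (v w : GenHeisenbergAlgebra f) :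
    coeffs f (v + w) = coeffs f v + coeffs f w := by simp [coeffs]

@[simp] lemma coeffs_zero : coeffs f 0 = 0 := by simp [coeffs]

lemma coeffs_mul (v w : GenHeisenbergAlgebra f) :
    coeffs f (v * w) = act f v (coeffs f w) := by
  rw [coeffs, map_mul, Module.End.mul_apply]; rfl

/-- The element with given coefficients. -/
noncomputable def ofCoeffs : (ℕ × ℕ →₀ ℂ[X]) →+ GenHeisenbergAlgebra f :=
  Finsupp.liftAddHom fun d =>
    { toFun := mono f d.1 d.2
      map_zero' := by simp [mono]
      map_add' := fun p q => by simp [mono, mul_add, add_mul] }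

lemma ofCoeffs_single (i k : ℕ) (p : ℂ[X]) :
    ofCoeffs f (Finsupp.single (i, k) p) = mono f i k p := by
  rw [ofCoeffs, Finsupp.liftAddHom_apply_single]; rfl

lemma coeffs_ofCoeffs (v : ℕ × ℕ →₀ ℂ[X]) (i k : ℕ) :
    coeffs f (ofCoeffs f v) i k = v (i, k) := by
  induction v using Finsupp.induction_linear with
  | zero => simp
  | add v w hv hw => simp [hv, hw]
  | single d p =>
    obtain ⟨a, b⟩ := d
    rw [ofCoeffs_single, coeffs_mono, Finsupp.single_apply]
    simp [eq_comm]

lemma aeval_h_mul_x_pow (p : ℂ[X]) (i : ℕ) :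
    aeval (gen f .h) p * gen f .x ^ i =
      gen f .x ^ i * aeval (gen f .h) (p.comp (f.comp^[i] X)) := by
  have one (p : ℂ[X]) : aeval (gen f .h) p * gen f .x =
      gen f .x * aeval (gen f .h) (p.comp f) := by
    induction p using Polynomial.induction_on with
    | C a => simpa using Algebra.commutes _ _
    | add p q hp hq => simp [hp, hq, add_mul, mul_add]
    | monomial n a ih =>
      have : (C a * X ^ (n + 1) : ℂ[X]) = C a * X ^ n * X := by ring
      rw [this, map_mul, aeval_X, mul_assoc, h_mul_x, ← mul_assoc, ih, mul_comp (C a * X ^ n) X,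
        X_comp, map_mul, mul_assoc]
  induction i generalizing p with
  | zero => simp
  | succ i ih =>
    rw [pow_succ, ← mul_assoc, ih, mul_assoc, one, ← mul_assoc, comp_assoc, iterate_comp_comp]

lemma y_mul_aeval_h (p : ℂ[X]) : gen f .y * aeval (gen f .h) p =
    aeval (gen f .h) (p.comp f) * gen f .y := by
  induction p using Polynomial.induction_on with
  | C a => simpa using (Algebra.commutes _ _).symm
  | add p q hp hq => simp [hp, hq, add_mul, mul_add]
  | monomial n a ih =>
    have : (C a * X ^ (n + 1) : ℂ[X]) = C a * X ^ n * X := by ring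
    rw [this, map_mul, aeval_X, ← mul_assoc, ih, mul_assoc, y_mul_h, mul_comp (C a * X ^ n) X,
        X_comp, map_mul, mul_assoc]

lemma y_mul_x_pow (i : ℕ) : gen f .y * gen f .x ^ (i + 1) =
    gen f .x ^ (i + 1) * gen f .y + gen f .x ^ i * aeval (gen f .h) (f.comp^[i + 1] X - X) := by
  induction i with
  | zero =>
    have := commutator_y_x f
    simp only [zero_add, pow_one, pow_zero, one_mul, map_sub, aeval_X, Function.iterate_one,
      comp_X]
    rw [← this]; abel
  | succ i ih =>
    have h1 := aeval_h_mul_x_pow f (f.comp^[i + 1] X - X) 1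
    have h2 : gen f .y * gen f .x =
        gen f .x * gen f .y + aeval (gen f .h) (f - X) := by
      rw [map_sub, aeval_X, ← commutator_y_x]; abel
    simp only [pow_one, Function.iterate_one, comp_X, sub_comp, iterate_comp_comp, X_comp] at h1
    rw [pow_succ _ (i + 1), ← mul_assoc, ih, add_mul, mul_assoc _ _ (gen f .x), h2,
      mul_assoc _ _ (gen f .x), h1, ← mul_assoc _ (gen f .x) (aeval _ _), ← pow_succ, mul_add,
      ← mul_assoc, ← pow_succ, add_assoc, ← mul_add, ← map_add]
    congr 3
    ring

/-- The span of the normal monomials contains 1 and is stable under left multiplication by each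
generator. -/
lemma ofCoeffs_surjective : Function.Surjective (ofCoeffs f) := by
  have hm (i k p) : mono f i k p ∈ (ofCoeffs f).range := ⟨_, ofCoeffs_single f i k p⟩
  have key (w : GenHeisenbergAlgebra f) : ∀ v ∈ (ofCoeffs f).range, w * v ∈ (ofCoeffs f).range := by
    have red (w : GenHeisenbergAlgebra f) (h : ∀ i k p, w * mono f i k p ∈ (ofCoeffs f).range) :
        ∀ v ∈ (ofCoeffs f).range, w * v ∈ (ofCoeffs f).range := by
      rintro _ ⟨v, rfl⟩
      induction v using Finsupp.induction_linear with
      | zero => simp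
      | add u v hu hv => rw [map_add, mul_add]; exact add_mem hu hv
      | single d p => rw [ofCoeffs_single f d.1 d.2 p]; exact h _ _ _
    induction w using gen_induction with
    | scalar r =>
      refine red _ fun i k p => ?_
      convert hm i k (C r * p) using 1
      simp only [mono, map_mul, aeval_C, ← mul_assoc]
      rw [Algebra.commutes r (gen f .x ^ i)]
    | hx =>
      refine red _ fun i k p => ?_
      convert hm (i + 1) k p using 1
      simp only [mono, pow_succ', mul_assoc]
    | hh =>
      refine red _ fun i k p => ?_
      convert hm i k (f.comp^[i] X * p) using 1
      have := aeval_h_mul_x_pow f X i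
      rw [aeval_X, X_comp] at this
      simp only [mono, map_mul, ← mul_assoc, this]
    | hy =>
      refine red _ fun i k p => ?_
      rcases i with _ | i
      · convert hm 0 (k + 1) (p.comp f) using 1
        simp only [mono, pow_zero, one_mul, ← mul_assoc, y_mul_aeval_h, pow_succ']
      · convert add_mem (hm (i + 1) (k + 1) (p.comp f)) (hm i k ((f.comp^[i + 1] X - X) * p))
          using 1
        simp only [mono, ← mul_assoc, y_mul_x_pow]
        rw [add_mul, add_mul, mul_assoc (gen f .x ^ (i + 1)), y_mul_aeval_h]
        simp only [mul_assoc, pow_succ', map_mul]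
    | add a b ha hb => intro v hv; rw [add_mul]; exact add_mem (ha v hv) (hb v hv)
    | mul a b ha hb => intro v hv; rw [mul_assoc]; exact ha _ (hb v hv)
  intro w
  have := key w (mono f 0 0 1) (hm _ _ _)
  simpa [mono] using this

end NormalForm

/-! ### Leading terms and their multiplicativity -/

section LeadingTerms

/-- The coefficients `v` vanish above `(i, k)` in the order that compares first the exponent of `y`
and then the exponent of `x`. -/
def VanishAbove (v : ℕ → ℕ → ℂ[X]) (i k : ℕ) : Prop :=
  ∀ i' k', (k < k' ∨ k = k' ∧ i < i') → v i' k' = 0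

lemma vanishAbove_opX_pow {v : ℕ → ℕ → ℂ[X]} {i k : ℕ} (hv : VanishAbove v i k) (n : ℕ) :
    VanishAbove ((opX ^ n) v) (n + i) k ∧ (opX ^ n) v (n + i) k = v i k := by
  refine ⟨fun i' k' h => ?_, by simp [opX_pow_apply]⟩
  rw [opX_pow_apply]
  split_ifs with h'
  · rfl
  · exact hv _ _ (by omega)

lemma vanishAbove_aeval_opH (f p : ℂ[X]) {v : ℕ → ℕ → ℂ[X]} {i k : ℕ} (hv : VanishAbove v i k) :
    VanishAbove (aeval (opH f) p v) i k := fun i' k' h => by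
  rw [aeval_opH_apply, hv _ _ h, mul_zero]

lemma vanishAbove_opY_pow (f : ℂ[X]) {v : ℕ → ℕ → ℂ[X]} {i k : ℕ} (hv : VanishAbove v i k)
    (n : ℕ) : VanishAbove ((opY f ^ n) v) i (n + k) ∧
      (opY f ^ n) v i (n + k) = (v i k).comp (f.comp^[n] X) := by
  induction n with
  | zero => simpa using hv
  | succ n ih =>
    rw [pow_succ', Module.End.mul_apply]
    set w := (opY f ^ n) v
    have e (i' k') : opY f w i' k' = (if k' = 0 then 0 else (w i' (k' - 1)).comp f) +
      (f.comp^[i' + 1] X - X) * w (i' + 1) k' := rfl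
    constructor
    · intro i' k' h
      rw [e, ih.1 (i' + 1) k' (by omega), if_neg (by omega), ih.1 i' (k' - 1) (by omega)]
      simp
    · rw [e, ih.1 (i + 1) _ (by omega), if_neg (by omega)]
      have : n + 1 + k - 1 = n + k := by omega
      rw [this, ih.2, comp_assoc, iterate_comp_comp]
      simp

lemma vanishAbove_act_mono (f p : ℂ[X]) {v : ℕ → ℕ → ℂ[X]} {i k : ℕ} (hv : VanishAbove v i k)
    (a b : ℕ) : VanishAbove (act f (mono f a b p) v) (a + i) (b + k) ∧
      act f (mono f a b p) v (a + i) (b + k) =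
        p.comp (f.comp^[i] X) * (v i k).comp (f.comp^[b] X) := by
  have e : act f (mono f a b p) v = (opX ^ a) (aeval (opH f) p ((opY f ^ b) v)) := by
    rw [mono, map_mul, map_mul, map_pow, map_pow, act_x, act_y, act_aeval_h]; rfl
  have h1 := vanishAbove_opY_pow f hv b
  have h2 := vanishAbove_aeval_opH f p h1.1
  have h3 := vanishAbove_opX_pow h2 a
  rw [e]
  exact ⟨h3.1, by rw [h3.2, aeval_opH_apply, h1.2]⟩

/-- Only the monomial of `w` at `(a, b)` can reach position `(a + i, b + k)`; moving `h` past `xⁱ`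
and `yᵇ` past `h` produces the two compositions. -/
lemma vanishAbove_coeffs_mul {f : ℂ[X]} {w w' : GenHeisenbergAlgebra f} {a b i k : ℕ}
    (h : VanishAbove (coeffs f w) a b) (h' : VanishAbove (coeffs f w') i k) :
    VanishAbove (coeffs f (w * w')) (a + i) (b + k) ∧
      coeffs f (w * w') (a + i) (b + k) =
        (coeffs f w a b).comp (f.comp^[i] X) * (coeffs f w' i k).comp (f.comp^[b] X) := by
  obtain ⟨v, rfl⟩ := ofCoeffs_surjective f w
  have e (i' k') : coeffs f (ofCoeffs f v * w') i' k' =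
      v.sum fun d p => act f (mono f d.1 d.2 p) (coeffs f w') i' k' := by
    have : ofCoeffs f v = v.sum fun d p => mono f d.1 d.2 p := rfl
    rw [coeffs_mul, this, Finsupp.sum, map_sum, LinearMap.sum_apply, Finset.sum_apply,
      Finset.sum_apply]
    rfl
  have hs (d : ℕ × ℕ) (hd : d ∈ v.support) : d.2 < b ∨ d.2 = b ∧ d.1 ≤ a := by
    by_contra hc
    rw [Finsupp.mem_support_iff, ← coeffs_ofCoeffs f v d.1 d.2] at hd
    exact hd (h _ _ (by omega))
  constructor
  · intro i' k' hk
    rw [e]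
    refine Finset.sum_eq_zero fun d hd => ?_
    have := hs d hd
    exact (vanishAbove_act_mono f _ h' _ _).1 _ _ (by omega)
  · rw [e, Finsupp.sum, Finset.sum_eq_single (a, b)]
    · rw [(vanishAbove_act_mono f _ h' _ _).2, coeffs_ofCoeffs]
    · intro d hd hne
      have := hs d hd
      have : ¬ (d.1 = a ∧ d.2 = b) := fun hh => hne (Prod.ext hh.1 hh.2)
      exact (vanishAbove_act_mono f _ h' _ _).1 _ _ (by omega)
    · intro hn
      rw [Finsupp.notMem_support_iff.mp hn]
      simp [mono]

/-- The leading term of `w` has exponent `i` in `x` and `k` in `y`. -/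
def IsLead {f : ℂ[X]} (w : GenHeisenbergAlgebra f) (i k : ℕ) : Prop :=
  coeffs f w i k ≠ 0 ∧ VanishAbove (coeffs f w) i k

lemma IsLead.unique {f : ℂ[X]} {w : GenHeisenbergAlgebra f} {i k i' k' : ℕ}
    (h : IsLead w i k) (h' : IsLead w i' k') : i = i' ∧ k = k' := by
  by_contra hc
  rcases (by omega : (k < k' ∨ k = k' ∧ i < i') ∨ (k' < k ∨ k' = k ∧ i' < i)) with hh | hh
  · exact h'.1 (h.2 _ _ hh)
  · exact h.1 (h'.2 _ _ hh)

lemma exists_isLead {f : ℂ[X]} {w : GenHeisenbergAlgebra f} (hw : w ≠ 0) :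
    ∃ i k, IsLead w i k := by
  obtain ⟨v, rfl⟩ := ofCoeffs_surjective f w
  have hv : v ≠ 0 := by rintro rfl; simp at hw
  obtain ⟨d, hd, hmax⟩ := Finset.exists_max_image v.support (fun d => toLex (d.2, d.1))
    (Finsupp.support_nonempty_iff.mpr hv)
  refine ⟨d.1, d.2, ?_, fun i k h => ?_⟩
  · rw [coeffs_ofCoeffs]; exact Finsupp.mem_support_iff.mp hd
  · rw [coeffs_ofCoeffs]
    by_contra hc
    have := hmax (i, k) (Finsupp.mem_support_iff.mpr hc)
    rw [Prod.Lex.toLex_le_toLex] at this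
    simp only at this
    omega

lemma comp_ne_zero_of_natDegree_pos {p q : ℂ[X]} (hp : p ≠ 0) (hq : 1 ≤ q.natDegree) :
    p.comp q ≠ 0 := by
  intro h
  rcases comp_eq_zero_iff.mp h with h | ⟨-, h⟩
  · exact hp h
  · rw [h, natDegree_C] at hq; omega

lemma natDegree_iterate_comp_X (f : ℂ[X]) (n : ℕ) :
    (f.comp^[n] X).natDegree = f.natDegree ^ n := by
  simp [natDegree_iterate_comp]

lemma natDegree_iterate_comp_X_pos {f : ℂ[X]} (hf : 1 ≤ f.natDegree) (n : ℕ) :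
    1 ≤ (f.comp^[n] X).natDegree := by
  rw [natDegree_iterate_comp_X]; exact Nat.one_le_pow _ _ hf

/-- Nonconstancy of `f` matters here: composing a nonzero coefficient with a nonconstant iterate
cannot give zero. -/
lemma IsLead.mul {f : ℂ[X]} (hf : 1 ≤ f.natDegree) {w w' : GenHeisenbergAlgebra f} {a b i k : ℕ}
    (h : IsLead w a b) (h' : IsLead w' i k) : IsLead (w * w') (a + i) (b + k) := by
  have := vanishAbove_coeffs_mul h.2 h'.2
  refine ⟨?_, this.1⟩
  rw [this.2]
  exact mul_ne_zero (comp_ne_zero_of_natDegree_pos h.1 (natDegree_iterate_comp_X_pos hf _))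
    (comp_ne_zero_of_natDegree_pos h'.1 (natDegree_iterate_comp_X_pos hf _))

theorem noZeroDivisors {f : ℂ[X]} (hf : 1 ≤ f.natDegree) :
    NoZeroDivisors (GenHeisenbergAlgebra f) where
  eq_zero_or_eq_zero_of_mul_eq_zero {v w} h := by
    by_contra! hc
    obtain ⟨a, b, h1⟩ := exists_isLead hc.1
    obtain ⟨i, k, h2⟩ := exists_isLead hc.2
    have := (h1.mul hf h2).1
    simp [h] at this

lemma coeffs_aeval_h (f p : ℂ[X]) (i k : ℕ) :
    coeffs f (aeval (gen f .h) p) i k = if i = 0 ∧ k = 0 then p else 0 := by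
  have := coeffs_mono f 0 0 p i k
  simpa [mono] using this

lemma aeval_h_injective (f : ℂ[X]) : Function.Injective (aeval (R := ℂ) (gen f .h)) := by
  intro p q h
  have := congrArg (fun w => coeffs f w 0 0) h
  simpa [coeffs_aeval_h] using this

lemma IsLead.eq_aeval_h {f : ℂ[X]} {w : GenHeisenbergAlgebra f} (h : IsLead w 0 0) :
    ∃ p : ℂ[X], w = aeval (gen f .h) p := by
  obtain ⟨v, rfl⟩ := ofCoeffs_surjective f w
  refine ⟨v (0, 0), ?_⟩
  have : v = Finsupp.single (0, 0) (v (0, 0)) := by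
    ext1 d
    by_cases hd : d = (0, 0)
    · simp [hd]
    · rw [Finsupp.single_eq_of_ne hd, ← coeffs_ofCoeffs f v d.1 d.2]
      have : ¬ (d.1 = 0 ∧ d.2 = 0) := fun hh => hd (Prod.ext hh.1 hh.2)
      exact h.2 _ _ (by omega)
  rw [this, ofCoeffs_single]
  simp [mono]

/-- Horner induction on `q`: away from exponent `(0, 0)`, adding the constant term does not disturb
the leading term. -/
lemma IsLead.aeval {f : ℂ[X]} (hf : 1 ≤ f.natDegree) {w : GenHeisenbergAlgebra f} {i k : ℕ}
    (h : IsLead w i k) (hne : ¬ (i = 0 ∧ k = 0)) (q : ℂ[X]) (hq : q ≠ 0) :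
    IsLead (aeval w q) (q.natDegree * i) (q.natDegree * k) := by
  obtain ⟨n, hn⟩ : ∃ n, q.natDegree = n := ⟨_, rfl⟩
  have scalar (r : ℂ) (i' k') (h0 : ¬ (i' = 0 ∧ k' = 0)) :
      coeffs f (algebraMap ℂ _ r) i' k' = 0 := by
    have := coeffs_aeval_h f (C r) i' k'
    rwa [aeval_C, if_neg h0] at this
  induction n generalizing q with
  | zero =>
    obtain ⟨r, rfl⟩ := natDegree_eq_zero.mp hn
    rw [natDegree_C, zero_mul, zero_mul, aeval_C, ← aeval_C (gen f .h)]
    refine ⟨by rw [coeffs_aeval_h]; simpa using hq, fun i' k' h' => ?_⟩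
    rw [coeffs_aeval_h, if_neg (by omega)]
  | succ n ih =>
    have hd : q.divX.natDegree = n := by rw [natDegree_divX_eq_natDegree_tsub_one, hn]; rfl
    have hq' : q.divX ≠ 0 := by
      intro h0
      rw [divX_eq_zero_iff] at h0
      rw [h0, natDegree_C] at hn
      omega
    have hl := h.mul hf (ih q.divX hq' hd)
    rw [hd] at hl
    have e : Polynomial.aeval w q =
        w * Polynomial.aeval w q.divX + algebraMap ℂ _ (q.coeff 0) := by
      have := congrArg (Polynomial.aeval w) (X_mul_divX_add q).symm
      rwa [map_add, map_mul, aeval_X, aeval_C] at this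
    have e1 (j : ℕ) : (n + 1) * j = j + n * j := by ring
    rw [hn, e1, e1, e]
    refine ⟨?_, fun i' k' h' => ?_⟩
    · rw [coeffs_add, Pi.add_apply, Pi.add_apply, scalar _ _ _ (by omega), add_zero]
      exact hl.1
    · rw [coeffs_add, Pi.add_apply, Pi.add_apply, scalar _ _ _ (by omega), add_zero]
      exact hl.2 _ _ h'

end LeadingTerms

/-! ### The image of `h` in degree at least two -/

section HigherDegree

/-- An eigenvector-like relation `t v = v f₁(t)` with `deg f₁ ≥ 2` forces `t` to be a polynomial
in `h`. -/
theorem exists_eq_aeval_h {f₁ f₂ : ℂ[X]} (hf₁ : 2 ≤ f₁.natDegree) (hf₂ : 1 ≤ f₂.natDegree)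
    {t v : GenHeisenbergAlgebra f₂} (hv : v ≠ 0) (h : t * v = v * aeval t f₁) :
    ∃ p : ℂ[X], t = aeval (gen f₂ .h) p := by
  by_cases ht : t = 0
  · exact ⟨0, by simp [ht]⟩
  obtain ⟨a, b, h1⟩ := exists_isLead ht
  obtain ⟨i, k, h2⟩ := exists_isLead hv
  by_cases h0 : a = 0 ∧ b = 0
  · rw [h0.1, h0.2] at h1
    exact h1.eq_aeval_h
  · have hne : f₁ ≠ 0 := by rintro rfl; simp at hf₁
    have h3 := h1.mul hf₂ h2
    rw [h] at h3
    -- The two leading exponents are `(a + i, b + k)` and `(i + d a, k + d b)` with `d = deg f₁ ≥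
    -- 2`, which forces `a = b = 0`.
    have h4 := h3.unique (h2.mul hf₂ (h1.aeval hf₂ h0 f₁ hne))
    have : a = f₁.natDegree * a := by omega
    have : b = f₁.natDegree * b := by omega
    have := Nat.mul_le_mul_right a hf₁
    have := Nat.mul_le_mul_right b hf₁
    omega

theorem exists_comp_eq {f₁ f₂ : ℂ[X]} {t : ℂ[X]} {v : GenHeisenbergAlgebra f₂} (hv : v ≠ 0)
    (h : aeval (gen f₂ .h) t * v = v * aeval (aeval (gen f₂ .h) t) f₁) :
    ∃ i k, t.comp (f₂.comp^[i] X) = (f₁.comp t).comp (f₂.comp^[k] X) := by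
  obtain ⟨i, k, h2⟩ := exists_isLead hv
  rw [← aeval_comp] at h
  have low (p : ℂ[X]) : VanishAbove (coeffs f₂ (aeval (gen f₂ .h) p)) 0 0 := fun i k h' => by
    rw [coeffs_aeval_h, if_neg (by omega)]
  have h3 := (vanishAbove_coeffs_mul (low t) h2.2).2
  have h4 := (vanishAbove_coeffs_mul h2.2 (low (f₁.comp t))).2
  rw [zero_add, zero_add, h] at h3
  rw [add_zero, add_zero, h3, coeffs_aeval_h, coeffs_aeval_h] at h4
  simp only [and_self, if_true, Function.iterate_zero, id, comp_X] at h4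
  refine ⟨i, k, mul_right_cancel₀ h2.1 ?_⟩
  rw [h4, mul_comm]

end HigherDegree

/-! ### Assembling the classification -/

section Classification

lemma gen_x_ne_zero {f : ℂ[X]} : gen f .x ≠ 0 := by
  intro h
  have h1 := coeffs_mono f 1 0 1 1 0
  have h2 : mono f 1 0 1 = gen f .x := by simp [mono]
  rw [h2, h] at h1
  simp at h1

/-- An isomorphism sends `h` to a polynomial in `h`, and intertwines the two polynomials up to
iteration. -/
lemma exists_image_h {f₁ f₂ : ℂ[X]} (hf₁ : 2 ≤ f₁.natDegree) (hf₂ : 1 ≤ f₂.natDegree)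
    (φ : GenHeisenbergAlgebra f₁ ≃ₐ[ℂ] GenHeisenbergAlgebra f₂) :
    ∃ t : ℂ[X], 1 ≤ t.natDegree ∧ φ (gen f₁ .h) = aeval (gen f₂ .h) t ∧
      ∃ i k, t.comp (f₂.comp^[i] X) = (f₁.comp t).comp (f₂.comp^[k] X) := by
  have tr := (isTriple_gen f₁).map φ.toAlgHom
  have hx : φ (gen f₁ .x) ≠ 0 := by simpa using gen_x_ne_zero
  obtain ⟨t, ht⟩ := exists_eq_aeval_h hf₁ hf₂ hx tr.hx
  change φ (gen f₁ .h) = _ at ht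
  refine ⟨t, ?_, ht, exists_comp_eq hx ?_⟩
  · by_contra hd
    obtain ⟨r, rfl⟩ := natDegree_eq_zero.mp (by omega : t.natDegree = 0)
    have : gen f₁ .h = aeval (gen f₁ .h) (C r) := by
      apply φ.injective
      rw [ht, aeval_C, aeval_C, φ.commutes]
    have := congrArg natDegree (aeval_h_injective f₁ ((aeval_X _).trans this))
    simp at this
  · have := tr.hx
    rwa [show φ.toAlgHom (gen f₁ .h) = _ from ht] at this

lemma natDegree_eq_pow {f₁ f₂ t : ℂ[X]} (ht : 1 ≤ t.natDegree) {i k : ℕ}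
    (h : t.comp (f₂.comp^[i] X) = (f₁.comp t).comp (f₂.comp^[k] X)) :
    f₂.natDegree ^ i = f₁.natDegree * f₂.natDegree ^ k := by
  have := congrArg natDegree h
  simp only [natDegree_comp, natDegree_iterate_comp_X] at this
  exact Nat.eq_of_mul_eq_mul_left ht (by rw [this]; ring)

lemma lt_of_pow_eq {m n i k : ℕ} (hm : 2 ≤ m) (hn : 1 ≤ n) (h : n ^ i = m * n ^ k) :
    k < i ∧ m = n ^ (i - k) ∧ 2 ≤ n := by
  have hn2 : 2 ≤ n := by
    by_contra hc
    have : n = 1 := by omega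
    subst this
    simp at h
    omega
  have hk : 0 < n ^ k := Nat.pow_pos (by omega)
  have hlt : k < i := by
    by_contra hc
    have := Nat.pow_le_pow_right hn (not_lt.mp hc)
    nlinarith
  refine ⟨hlt, ?_, hn2⟩
  apply Nat.eq_of_mul_eq_mul_right hk
  rw [← h, ← pow_add]
  congr 1
  omega

/-- For constant `f₂ = r` the product `(h - r) x` is zero with both factors nonzero, whereas the
algebra of `f₁` is a domain. -/
lemma natDegree_pos_of_equiv {f₁ f₂ : ℂ[X]} (hf₁ : 2 ≤ f₁.natDegree)
    (φ : GenHeisenbergAlgebra f₁ ≃ₐ[ℂ] GenHeisenbergAlgebra f₂) : 1 ≤ f₂.natDegree := by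
  by_contra hd
  obtain ⟨r, rfl⟩ := natDegree_eq_zero.mp (by omega : f₂.natDegree = 0)
  have := noZeroDivisors (f := f₁) (by omega)
  have h0 : (gen (C r) .h - algebraMap ℂ _ r) * gen (C r) .x = 0 := by
    rw [sub_mul, h_mul_x, aeval_C, Algebra.commutes, sub_self]
  have h1 := congrArg φ.symm h0
  rw [map_mul, map_zero, mul_eq_zero] at h1
  rcases h1 with h1 | h1
  · rw [map_eq_zero_iff _ φ.symm.injective, sub_eq_zero, ← aeval_X (R := ℂ) (gen (C r) .h),
      ← aeval_C (gen (C r) .h)] at h1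
    have := congrArg natDegree (aeval_h_injective _ h1)
    simp at this
  · rw [map_eq_zero_iff _ φ.symm.injective] at h1
    exact gen_x_ne_zero h1

theorem affine_conj_of_equiv {f₁ f₂ : ℂ[X]} (hf₁ : 2 ≤ f₁.natDegree)
    (φ : GenHeisenbergAlgebra f₁ ≃ₐ[ℂ] GenHeisenbergAlgebra f₂) :
    2 ≤ f₂.natDegree ∧ ∃ a c : ℂ, a ≠ 0 ∧ f₂ = C a * f₁.comp (C a⁻¹ * (X - C c)) + C c := by
  have hf₂ := natDegree_pos_of_equiv hf₁ φ
  obtain ⟨t, ht, hφ, i, k, e⟩ := exists_image_h hf₁ hf₂ φ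
  obtain ⟨hik, hm, hn⟩ := lt_of_pow_eq hf₁ hf₂ (natDegree_eq_pow ht e)
  refine ⟨hn, ?_⟩
  obtain ⟨s, hs, hψ, i', k', e'⟩ := exists_image_h hn (by omega : 1 ≤ f₁.natDegree) φ.symm
  obtain ⟨hik', hm', -⟩ := lt_of_pow_eq hn (by omega) (natDegree_eq_pow hs e')
  -- Each degree is a power of the other, so the product of the exponents `i - k` and `i' - k'` is
  -- 1.
  have hi : i = k + 1 := by
    have h1 : f₁.natDegree = f₁.natDegree ^ ((i' - k') * (i - k)) := by
      rw [pow_mul, ← hm', ← hm]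
    have h2 := Nat.pow_right_injective hf₁ (h1.symm.trans (pow_one _).symm)
    have := Nat.eq_one_of_mul_eq_one_left h2
    omega
  subst hi
  -- Right composition with the nonconstant iterate `f₂ᵏ` can be cancelled.
  have conj : t.comp f₂ = f₁.comp t := by
    rw [Function.iterate_succ_apply', ← comp_assoc] at e
    have h0 : (t.comp f₂ - f₁.comp t).comp (f₂.comp^[k] X) = 0 := by
      rw [sub_comp, e, sub_self]
    by_contra hc
    exact comp_ne_zero_of_natDegree_pos (sub_ne_zero.mpr hc)
      (natDegree_iterate_comp_X_pos hf₂ k) h0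
  have hst : t.comp s = X := by
    apply aeval_h_injective f₁
    rw [aeval_comp, ← hψ, aeval_X, aeval_algHom_apply φ.symm, ← hφ, φ.symm_apply_apply]
  have hd : t.natDegree = 1 := by
    have := congrArg natDegree hst
    rw [natDegree_comp, natDegree_X] at this
    exact Nat.eq_one_of_mul_eq_one_right this
  obtain ⟨α, hα, β, rfl⟩ := natDegree_eq_one.mp hd
  -- Solving `α f₂ + β = f₁(α X + β)` for `f₂` gives these constants.
  refine ⟨α⁻¹, -(α⁻¹ * β), inv_ne_zero hα, ?_⟩
  have hC : (C α⁻¹ : ℂ[X]) * C α = 1 := by rw [← C_mul, inv_mul_cancel₀ hα, C_1]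
  have : (C α⁻¹⁻¹ * (X - C (-(α⁻¹ * β))) : ℂ[X]) = C α * X + C β := by
    rw [inv_inv, C_neg, C_mul]
    linear_combination C β * hC
  rw [this, ← conj]
  simp only [add_comp, mul_comp, C_comp, X_comp, C_neg, C_mul]
  linear_combination (-f₂) * hC

lemma eq_linear_of_natDegree_lt {f : ℂ[X]} (hf : ¬ 2 ≤ f.natDegree) :
    ∃ a b : ℂ, f = C a * X + C b :=
  ⟨_, _, eq_X_add_C_of_natDegree_le_one (by omega)⟩

lemma not_equiv_X_add_C {b : ℂ} (hb : b ≠ 0)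
    (φ : GenHeisenbergAlgebra X ≃ₐ[ℂ] GenHeisenbergAlgebra (X + C b)) : False := by
  have t := isTriple_gen X
  obtain ⟨t1, t2, t3⟩ := t
  simp only [aeval_X, sub_self] at t1 t2 t3
  have := (commute_of_commute_gen φ.toAlgHom
    (Commute.map (sub_eq_zero.mp t3).symm φ) (Commute.map t1.symm φ) (Commute.map t2 φ)
    (φ.symm (gen _ .x)) (φ.symm (gen _ .y))).eq
  have e := commutator_y_x (X + C b)
  have this' : gen (X + C b) .x * gen (X + C b) .y = gen (X + C b) .y * gen (X + C b) .x := by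
    simpa using this
  rw [this', sub_self, map_add, aeval_X, add_sub_cancel_left] at e
  have := aeval_h_injective _ (e.symm.trans (map_zero _).symm)
  exact hb (C_eq_zero.mp this)

theorem nonempty_equiv_of_inv {a₁ a₂ b₁ b₂ : ℂ} (h : a₁ = a₂ ∨ a₁ = a₂⁻¹) (h1 : a₁ ≠ 1) :
    Nonempty (GenHeisenbergAlgebra (C a₁ * X + C b₁) ≃ₐ[ℂ]
      GenHeisenbergAlgebra (C a₂ * X + C b₂)) := by
  have same (a b₁ b₂ : ℂ) (ha : a ≠ 1) : Nonempty (GenHeisenbergAlgebra (C a * X + C b₁) ≃ₐ[ℂ]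
      GenHeisenbergAlgebra (C a * X + C b₂)) :=
    (nonempty_equiv_linear a b₁ ha).elim fun φ =>
      (nonempty_equiv_linear a b₂ ha).elim fun ψ => ⟨φ.symm.trans ψ⟩
  rcases h with rfl | h
  · exact same _ _ _ h1
  -- With the convention `0⁻¹ = 0`, a zero slope falls back to the case of equal slopes.
  · by_cases h0 : a₁ = 0
    · have : a₂ = a₁ := by rw [h0] at h ⊢; exact inv_eq_zero.mp h.symm
      subst this
      exact same _ _ _ h1
    · obtain rfl : a₂ = a₁⁻¹ := by rw [h, inv_inv]
      obtain ⟨φ⟩ := nonempty_equiv_linear a₁ b₁ h1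
      obtain ⟨χ⟩ := nonempty_equiv_linear_inv h0
      obtain ⟨ψ⟩ := nonempty_equiv_linear a₁⁻¹ b₂ (by simpa using h1)
      exact ⟨φ.symm.trans (χ.trans ψ)⟩

end Classification

end GenHeisenberg

open GenHeisenberg in
theorem theorem5 (f₁ f₂ : ℂ[X]) :
    Nonempty (GenHeisenbergAlgebra f₁ ≃ₐ[ℂ] GenHeisenbergAlgebra f₂) ↔
      ((∃ c₁ c₂ : ℂ, f₁ = C c₁ ∧ f₂ = C c₂) ∨
       (f₁ = X ∧ f₂ = X) ∨
       (∃ c₁ c₂ : ℂ, c₁ ≠ 0 ∧ c₂ ≠ 0 ∧ f₁ = X + C c₁ ∧ f₂ = X + C c₂) ∨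
       (∃ a₁ a₂ b₁ b₂ : ℂ, f₁ = C a₁ * X + C b₁ ∧ f₂ = C a₂ * X + C b₂ ∧
          (a₁ = a₂ ∨ a₁ = a₂⁻¹) ∧ a₁ ≠ 1) ∨
       (2 ≤ f₁.natDegree ∧ ∃ a c : ℂ, a ≠ 0 ∧
          f₂ = C a * f₁.comp (C a⁻¹ * (X - C c)) + C c)) := by
  constructor
  · rintro ⟨φ⟩
    by_cases hd₁ : 2 ≤ f₁.natDegree
    · exact .inr (.inr (.inr (.inr ⟨hd₁, (affine_conj_of_equiv hd₁ φ).2⟩)))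
    by_cases hd₂ : 2 ≤ f₂.natDegree
    · exact absurd (affine_conj_of_equiv hd₂ φ.symm).1 hd₁
    obtain ⟨a₁, b₁, hf₁⟩ := eq_linear_of_natDegree_lt hd₁
    obtain ⟨a₂, b₂, hf₂⟩ := eq_linear_of_natDegree_lt hd₂
    by_cases h2 : a₂ = 1
    · by_cases h1 : a₁ = 1
      · subst h1 h2
        simp only [C_1, one_mul] at hf₁ hf₂
        subst hf₁ hf₂
        by_cases hb₁ : b₁ = 0 <;> by_cases hb₂ : b₂ = 0
        · exact .inr (.inl (by simp [hb₁, hb₂]))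
        · rw [hb₁, C_0, add_zero] at φ
          exact (not_equiv_X_add_C hb₂ φ).elim
        · rw [hb₂, C_0, add_zero] at φ
          exact (not_equiv_X_add_C hb₁ φ.symm).elim
        · exact .inr (.inr (.inl ⟨b₁, b₂, hb₁, hb₂, rfl, rfl⟩))
      · exact absurd h2 (linear_of_equiv hf₂ hf₁ h1 φ.symm).1
    · obtain ⟨h1, h⟩ := linear_of_equiv hf₁ hf₂ h2 φ
      exact .inr (.inr (.inr (.inl ⟨a₁, a₂, b₁, b₂, hf₁, hf₂,
        h.imp_right eq_inv_of_mul_eq_one_left, h1⟩)))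
  · rintro (⟨c₁, c₂, rfl, rfl⟩ | ⟨rfl, rfl⟩ | ⟨c₁, c₂, h₁, h₂, rfl, rfl⟩ |
      ⟨a₁, a₂, b₁, b₂, rfl, rfl, h, h1⟩ | ⟨-, a, c, ha, h⟩)
    · refine nonempty_equiv_of_affine_conj (a := 1) (c := c₂ - c₁) one_ne_zero ?_
      simp
    · exact ⟨AlgEquiv.refl⟩
    -- Conjugation by scaling with `a` fixes the slope and multiplies the constant term by `a`.
    · refine nonempty_equiv_of_affine_conj (a := c₂ / c₁) (c := 0) (div_ne_zero h₂ h₁) ?_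
      have e1 : (C (c₂ / c₁) : ℂ[X]) * C (c₂ / c₁)⁻¹ = 1 := by
        rw [← C_mul, mul_inv_cancel₀ (div_ne_zero h₂ h₁), C_1]
      have e2 : (C (c₂ / c₁) : ℂ[X]) * C c₁ = C c₂ := by
        rw [← C_mul, div_mul_cancel₀ _ h₁]
      simp only [add_comp, X_comp, C_comp, C_0, sub_zero, add_zero]
      linear_combination (-X) * e1 - e2
    · exact nonempty_equiv_of_inv h h1
    · exact nonempty_equiv_of_affine_conj ha h
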